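/- A game consists of a finite set $\Pi$ of players, a finite directed graph $(V,E)$ in which every vertex has at least one outgoing edge, a partition $(V_i)_{i\in\Pi}$ of $V$ (blocks may be empty; player $i$ controls the vertices in $V_i$), and a payoff function $\mu=(\mu_i)_{i\in\Pi}: V^\omega\to\{0,1\}^\Pi$. Plays (resp. histories) are infinite (resp. non-empty finite) paths in $(V,E)$. The game is a parity game if there are colour functions $\kappa_i:V\to\mathbb{N}$ $(i\in\Pi)$ such that for every play $\rho$ and every player $i$, $\mu_i(\rho)=1$ if and only if the least colour $\min\kappa_i(\mathrm{Inf}(\rho))$ is even, where $\mathrm{Inf}(\rho)$ is the set of vertices that occur infinitely often in $\rho$. For an initial vertex $v_0$, a strategy of player $i$ maps every history $hv$ starting at $v_0$ and ending in some $v\in V_i$ to a successor of $v$; a strategy profile $\bar\sigma=(\sigma_i)_{i\in\Pi}$ determines a unique play from $v_0$, its outcome. The profile is a Nash equilibrium if no player $i$ can strictly increase the payoff $\mu_i$ of the outcome by replacing $\sigma_i$ alone by another strategy. It is a subgame-perfect equilibrium if for every history $hv$ starting at $v_0$, the profile of the substrategies $h'\mapsto\sigma_i(hh')$ is a Nash equilibrium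 in the game initialized at $v$ with payoff function $\rho\mapsto\mu(h\rho)$. **Theorem.** For every parity game $G$ and every initial vertex $v_0$ of $G$, there exists a subgame-perfect equilibrium in $G$ initialized at $v_0$. -/

import Mathlib

/-- A Boolean turn-based game with players `P`, played on a directed graph with states `V` in which
every state has an outgoing transition.  The partition of the states among the players is given by
`owner`: player `i` controls the states `v` with `owner v = i`.  The finiteness of `P` and `V` is
required by separate instance arguments wherever it matters. -/
structure BoolGame (P V : Type*) where
  /-- the states and transitions -/
  graph : Digraph V
  exists_succ : ∀ v, ∃ w, graph.Adj v w
  /-- the player who controls a state -/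
  owner : V → P
  /-- the payoff function: player `i` wins `ρ` if `payoff ρ i = 1`, and loses otherwise -/
  payoff : (ℕ → V) → P → Fin 2

namespace BoolGame

variable {P V : Type*}

/-- Plays: infinite paths in the graph. -/
def IsPlay (G : BoolGame P V) (ρ : ℕ → V) : Prop :=
  ∀ n, G.graph.Adj (ρ n) (ρ (n + 1))

/-- Histories of the game initialized at `v₀`: (non-empty) finite paths in the graph that start
at `v₀`. -/
def IsHistory (G : BoolGame P V) (v₀ : V) (h : List V) : Prop :=
  h.head? = some v₀ ∧ h.IsChain G.graph.Adj

/-- The set of the states that occur infinitely often in `ρ`. -/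
def infOcc (ρ : ℕ → V) : Set V :=
  {v | ∃ᶠ n in Filter.atTop, ρ n = v}

/-- The infinite sequence `hρ`. -/
def prepend (h : List V) (ρ : ℕ → V) : ℕ → V :=
  fun n => h[n]?.getD (ρ (n - h.length))

/-- Parity games: there are colour functions `κ i : V → ℕ` such that a play is won by player `i`
iff the least colour that player `i` sees infinitely often is even. -/
def IsParity (G : BoolGame P V) : Prop :=
  ∃ κ : P → V → ℕ, ∀ ρ, G.IsPlay ρ → ∀ i,
    (G.payoff ρ i = 1 ↔ Even (sInf (κ i '' infOcc ρ)))

/-- Strategies of player `i` in the game initialized at `v₀`.  For a history `hv` whose last state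
`v` is controlled by player `i`, `next h v` is the state chosen after `hv`; the other values of
`next` are irrelevant. -/
structure Strategy (G : BoolGame P V) (v₀ : V) (i : P) where
  next : List V → V → V
  adj_next : ∀ h v, G.IsHistory v₀ (h ++ [v]) → G.owner v = i → G.graph.Adj v (next h v)

/-- Complete strategy profiles in the game initialized at `v₀`. -/
abbrev Profile (G : BoolGame P V) (v₀ : V) :=
  ∀ i, G.Strategy v₀ i

/-- The history of length `n + 1` that results from `σ`, as a pair of its part before the last
state and its last state. -/
def run (G : BoolGame P V) {v₀ : V} (σ : G.Profile v₀) : ℕ → List V × V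
  | 0 => ([], v₀)
  | n + 1 =>
    let p := run G σ n
    (p.1 ++ [p.2], (σ (G.owner p.2)).next p.1 p.2)

/-- The outcome of a complete strategy profile: the unique play from `v₀` compatible with it. -/
def outcome (G : BoolGame P V) {v₀ : V} (σ : G.Profile v₀) : ℕ → V :=
  fun n => (G.run σ n).2

open Classical in
/-- Nash equilibria of the game initialized at `v₀`. -/
def IsNash (G : BoolGame P V) {v₀ : V} (σ : G.Profile v₀) : Prop :=
  ∀ (i : P) (τ : G.Strategy v₀ i),
    G.payoff (G.outcome (Function.update σ i τ)) i ≤ G.payoff (G.outcome σ) i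

/-- The game whose payoffs assume that `h` has already been played.  The subgame after a history
`hv` is `G.after h` initialized at `v`. -/
def after (G : BoolGame P V) (h : List V) : BoolGame P V where
  graph := G.graph
  exists_succ := G.exists_succ
  owner := G.owner
  payoff := fun ρ => G.payoff (prepend h ρ)

theorem IsHistory.append {G : BoolGame P V} {v₀ v : V} {h g : List V}
    (hh : G.IsHistory v₀ (h ++ [v])) (hg : G.IsHistory v g) : G.IsHistory v₀ (h ++ g) := by
  obtain ⟨h1, h2⟩ := hh
  obtain ⟨g1, g2⟩ := hg
  cases g with
  | nil => simp at g1
  | cons a t =>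
    obtain rfl : a = v := by simpa using g1
    refine ⟨?_, ?_⟩
    · cases h <;> simpa using h1
    · rw [List.isChain_append] at h2 ⊢
      exact ⟨h2.1, g2, by simpa using h2.2.2⟩

/-- The substrategy after the history `hv`: it maps `h'` to the value of the strategy at `hh'`. -/
def Strategy.sub {G : BoolGame P V} {v₀ : V} {i : P} (σ : G.Strategy v₀ i) (h : List V) (v : V)
    (hv : G.IsHistory v₀ (h ++ [v])) : (G.after h).Strategy v i where
  next := fun g w => σ.next (h ++ g) w
  adj_next := fun g w hg hw =>
    σ.adj_next (h ++ g) w (by simpa using hv.append (g := g ++ [w]) hg) hw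

/-- Subgame-perfect equilibria of the game initialized at `v₀`. -/
def IsSPE (G : BoolGame P V) {v₀ : V} (σ : G.Profile v₀) : Prop :=
  ∀ (h : List V) (v : V) (hv : G.IsHistory v₀ (h ++ [v])),
    (G.after h).IsNash (fun i => (σ i).sub h v hv)

end BoolGame

/-! For each player `i`, consider the two-player game of `i` against the coalition of all others. By
positional determinacy (`exists_regions`), each state is winning for one side by a positional
strategy. `exists_pruned` deletes transitions until `i` wins every remaining play from her winning
region `W i`, while none of her transitions outside `W i` is lost.

All players follow an arbitrary remaining transition `f`; whoever last deviated, say `j`, is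
punished by the coalition strategy `t j` outside `W j`. All prescribed moves, punishments included,
are remaining transitions. Hence, after any history, a prescribed play that `i` loses never meets `W
i`. Her own moves cannot enter `W i` from outside, and once she deviates the coalition keeps the
play outside `W i` and makes her lose. Winning depends only on the tail of a play, so past history
is irrelevant. -/

namespace BoolGame

/-! ### Positional determinacy of two-player parity games -/

section Determinacy

variable {V : Type*}

theorem infOcc_shift (ρ : ℕ → V) (k : ℕ) : infOcc (fun n => ρ (n + k)) = infOcc ρ := by
  ext v
  simp only [infOcc, Set.mem_ofPred_eq, Filter.frequently_atTop]
  constructor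
  · intro h a
    obtain ⟨b, hb, e⟩ := h a
    exact ⟨b + k, by omega, e⟩
  · intro h a
    obtain ⟨b, hb, e⟩ := h (a + k)
    exact ⟨b - k, by omega, by rw [Nat.sub_add_cancel (by omega)]; exact e⟩

/-- The least colour seen infinitely often is even if `p = true`, and odd if `p = false`. -/
def ParityWin (κ : V → ℕ) (p : Bool) (ρ : ℕ → V) : Prop :=
  Even (sInf (κ '' infOcc ρ)) ↔ p = true

theorem ParityWin.of_shift {κ : V → ℕ} {p : Bool} {ρ : ℕ → V} (k : ℕ)
    (h : ParityWin κ p (fun n => ρ (n + k))) : ParityWin κ p ρ := by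
  rwa [ParityWin, infOcc_shift] at h

/-- By the pigeonhole principle, a single state of colour `d` recurs infinitely often. -/
theorem ParityWin.of_frequently_min [Finite V] {κ : V → ℕ} {ρ : ℕ → V} {d : ℕ}
    (hd : ∀ n, d ≤ κ (ρ n)) (hf : ∀ n, ∃ m ≥ n, κ (ρ m) = d) :
    ParityWin κ (decide (Even d)) ρ := by
  have hex : ∃ v ∈ {v | κ v = d}, ∃ᶠ n in Filter.atTop, ρ n = v := by
    by_contra! hc
    have := (Filter.eventually_all_finite (Set.toFinite {v | κ v = d})).2 hc
    obtain ⟨n, hn⟩ := Filter.eventually_atTop.1 this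
    obtain ⟨m, hm, e⟩ := hf n
    exact hn m hm (ρ m) e rfl
  obtain ⟨v, hv, hfr⟩ := hex
  have : sInf (κ '' infOcc ρ) = d := by
    apply le_antisymm
    · exact Nat.sInf_le ⟨v, hfr, hv⟩
    · refine le_csInf ⟨_, v, hfr, rfl⟩ ?_
      rintro _ ⟨w, hw, rfl⟩
      obtain ⟨n, rfl⟩ := Filter.Frequently.exists hw
      exact hd n
  simp [ParityWin, this]

/-- `s` is a positional strategy of player `p` that keeps every play of the game restricted to `U`
that starts in `W` inside `W`, and wins it. -/
structure Region (E : V → V → Prop) (own : V → Bool) (κ : V → ℕ) (U : Set V) (p : Bool)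
    (W : Set V) (s : V → V) : Prop where
  subset : W ⊆ U
  move : ∀ v ∈ W, own v = p → E v (s v) ∧ s v ∈ W
  closed : ∀ v ∈ W, own v ≠ p → ∀ w ∈ U, E v w → w ∈ W
  wins : ∀ ρ : ℕ → V, (∀ n, ρ n ∈ W) → (∀ n, E (ρ n) (ρ (n + 1))) →
    (∀ n, own (ρ n) = p → ρ (n + 1) = s (ρ n)) → ParityWin κ p ρ

variable {E : V → V → Prop} {own : V → Bool} {κ : V → ℕ} {U W Y A N : Set V} {p : Bool}
  {s t : V → V}

theorem Region.empty : Region E own κ U p ∅ s :=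
  ⟨Set.empty_subset _, by simp, by simp, fun _ h => (h 0).elim⟩

/-- The opponent cannot escape into `W`, so winning in the subgame is winning in `U`. -/
theorem Region.of_diff (h : Region E own κ (U \ W) p Y s)
    (hW : ∀ v ∈ U \ W, own v ≠ p → ∀ w ∈ W, ¬ E v w) : Region E own κ U p Y s where
  subset := h.subset.trans Set.sdiff_subset
  move := h.move
  closed v hv ho w hw e := h.closed v hv ho w ⟨hw, fun hw' => hW v (h.subset hv) ho w hw' e⟩ e
  wins := h.wins

/-- A play that enters `W` stays there under `s`; any other play is won by `t` inside `Y`. -/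
theorem Region.extend (h : Region E own κ U p W s) (h' : Region E own κ (U \ W) p Y t) :
    ∃ r, Region E own κ U p (W ∪ Y) r := by
  classical
  have hYW : ∀ v ∈ Y, v ∉ W := fun v hv => (h'.subset hv).2
  refine ⟨fun v => if v ∈ W then s v else t v, ?_, ?_, ?_, ?_⟩
  · exact Set.union_subset h.subset (h'.subset.trans Set.sdiff_subset)
  · rintro v (hv | hv) ho
    · simpa [hv] using ⟨(h.move v hv ho).1, Or.inl (h.move v hv ho).2⟩
    · simpa [hYW v hv] using ⟨(h'.move v hv ho).1, Or.inr (h'.move v hv ho).2⟩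
  · rintro v (hv | hv) ho w hw e
    · exact Or.inl (h.closed v hv ho w hw e)
    · by_cases hwW : w ∈ W
      · exact Or.inl hwW
      · exact Or.inr (h'.closed v hv ho w ⟨hw, hwW⟩ e)
  · intro ρ hρ hE hs
    have hU : ∀ n, ρ n ∈ U := fun n =>
      (hρ n).elim (fun x => h.subset x) (fun x => (h'.subset x).1)
    by_cases hex : ∃ n, ρ n ∈ W
    · obtain ⟨k, hk⟩ := hex
      have hstay : ∀ n, ρ (n + k) ∈ W := by
        intro n
        induction n with
        | zero => simpa using hk
        | succ n ih =>
          rw [show n + 1 + k = n + k + 1 by omega]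
          by_cases ho : own (ρ (n + k)) = p
          · rw [hs _ ho, if_pos ih]
            exact (h.move _ ih ho).2
          · exact h.closed _ ih ho _ (hU _) (hE _)
      refine ParityWin.of_shift k (h.wins _ hstay (fun n => ?_) (fun n ho => ?_))
      · simpa only [show n + 1 + k = n + k + 1 by omega] using hE (n + k)
      · simpa only [show n + 1 + k = n + k + 1 by omega, if_pos (hstay n)] using hs (n + k) ho
    · push Not at hex
      exact h'.wins ρ (fun n => (hρ n).resolve_left (hex n)) hE
        (fun n ho => by rw [hs n ho, if_neg (hex n)])

/-- Player `p` controls `v` and has a transition to `W`, or cannot be prevented from entering `W`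
in the next step. -/
def Forces (E : V → V → Prop) (own : V → Bool) (U : Set V) (p : Bool) (W : Set V) (v : V) : Prop :=
  (own v = p ∧ ∃ w ∈ W, E v w) ∨ (own v ≠ p ∧ ∀ w ∈ U, E v w → w ∈ W)

/-- The complement of a set closed under forcing is again a game without dead ends, so induction
applies to it. -/
theorem exists_succ_diff (hU : ∀ v ∈ U, ∃ w ∈ U, E v w)
    (hW : ∀ v ∈ U, Forces E own U p W v → v ∈ W) :
    ∀ v ∈ U \ W, ∃ w ∈ U \ W, E v w := by
  rintro v ⟨hv, hvW⟩
  by_contra! hc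
  refine hvW (hW v hv ?_)
  have hall : ∀ w ∈ U, E v w → w ∈ W := fun w hw e => by
    by_contra hwW
    exact hc w ⟨hw, hwW⟩ e
  by_cases ho : own v = p
  · obtain ⟨w, hw, e⟩ := hU v hv
    exact Or.inl ⟨ho, w, hall w hw e, e⟩
  · exact Or.inr ⟨ho, hall⟩

theorem Region.insert (h : Region E own κ U p W s) {v : V} (hvU : v ∈ U) (hvW : v ∉ W)
    (hv : Forces E own U p W v) : ∃ r, Region E own κ U p (insert v W) r := by
  classical
  obtain ⟨w₀, hw₀⟩ : ∃ w₀, own v = p → w₀ ∈ W ∧ E v w₀ := by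
    rcases hv with ⟨_, w, hw, e⟩ | ⟨ho, _⟩
    · exact ⟨w, fun _ => ⟨hw, e⟩⟩
    · exact ⟨v, fun h => (ho h).elim⟩
  have hne : ∀ x ∈ W, x ≠ v := fun x hx e => hvW (e ▸ hx)
  have hcl : own v ≠ p → ∀ w ∈ U, E v w → w ∈ W := fun ho =>
    hv.elim (fun h => (ho h.1).elim) (fun h => h.2)
  refine ⟨Function.update s v w₀, ?_, ?_, ?_, ?_⟩
  · exact Set.insert_subset hvU h.subset
  · rintro x (rfl | hx) ho
    · simpa using ⟨(hw₀ ho).2, Or.inr (hw₀ ho).1⟩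
    · rw [Function.update_of_ne (hne x hx)]
      exact ⟨(h.move x hx ho).1, Or.inr (h.move x hx ho).2⟩
  · rintro x (rfl | hx) ho w hw e
    · exact Or.inr (hcl ho w hw e)
    · exact Or.inr (h.closed x hx ho w hw e)
  · intro ρ hρ hE hs
    have hU : ∀ n, ρ n ∈ U := fun n => (hρ n).elim (fun x => x ▸ hvU) (fun x => h.subset x)
    have hstay : ∀ n, ρ (n + 1) ∈ W := by
      intro n
      rcases hρ n with hx | hx
      · by_cases ho : own (ρ n) = p
        · rw [hs n ho, hx, Function.update_self]
          exact (hw₀ (hx ▸ ho)).1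
        · rw [hx] at ho
          exact hcl ho _ (hU _) (hx ▸ hE n)
      · by_cases ho : own (ρ n) = p
        · rw [hs n ho, Function.update_of_ne (hne _ hx)]
          exact (h.move _ hx ho).2
        · exact h.closed _ hx ho _ (hU _) (hE n)
    refine ParityWin.of_shift 1 (h.wins _ hstay (fun n => hE (n + 1)) (fun n ho => ?_))
    rw [hs (n + 1) ho, Function.update_of_ne (hne _ (hstay n))]

/-- From every state in `A`, the positional strategy `s` of player `p` forces a visit to `N`
without leaving `A`; the rank `r` decreases until `N` is reached. -/
structure Attracts (E : V → V → Prop) (own : V → Bool) (U : Set V) (p : Bool) (N A : Set V)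
    (s : V → V) (r : V → ℕ) : Prop where
  subset : A ⊆ U
  target : N ⊆ A
  move : ∀ v ∈ A, v ∉ N → own v = p → E v (s v) ∧ s v ∈ A ∧ r (s v) < r v
  closed : ∀ v ∈ A, v ∉ N → own v ≠ p → ∀ w ∈ U, E v w → w ∈ A ∧ r w < r v

theorem Attracts.insert [Finite V] {r : V → ℕ} (h : Attracts E own U p N A s r) {v : V}
    (hvU : v ∈ U) (hvA : v ∉ A) (hv : Forces E own U p A v) :
    ∃ s' r', Attracts E own U p N (insert v A) s' r' := by
  classical
  obtain ⟨w₀, hw₀⟩ : ∃ w₀, own v = p → w₀ ∈ A ∧ E v w₀ := by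
    rcases hv with ⟨_, w, hw, e⟩ | ⟨ho, _⟩
    · exact ⟨w, fun _ => ⟨hw, e⟩⟩
    · exact ⟨v, fun h => (ho h).elim⟩
  obtain ⟨b, hb⟩ := (Set.finite_range r).bddAbove
  have hb : ∀ x, r x < b + 1 := fun x => Nat.lt_succ_of_le (hb ⟨x, rfl⟩)
  have hne : ∀ x ∈ A, x ≠ v := fun x hx e => hvA (e ▸ hx)
  have hcl : own v ≠ p → ∀ w ∈ U, E v w → w ∈ A := fun ho =>
    hv.elim (fun h => (ho h.1).elim) (fun h => h.2)
  -- The rank `b + 1` exceeds all existing ranks, so entering `A` from `v` decreases the rank.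
  refine ⟨Function.update s v w₀, Function.update r v (b + 1), ?_, ?_, ?_, ?_⟩
  · exact Set.insert_subset hvU h.subset
  · exact h.target.trans (Set.subset_insert _ _)
  · rintro x (rfl | hx) hN ho
    · obtain ⟨hA, e⟩ := hw₀ ho
      simp [e, hA, Function.update_of_ne (hne _ hA), hb]
    · obtain ⟨h1, h2, h3⟩ := h.move x hx hN ho
      simp [Function.update_of_ne (hne _ hx), Function.update_of_ne (hne _ h2), h1, h2, h3]
  · rintro x (rfl | hx) hN ho w hw e
    · have hA := hcl ho w hw e
      simp [hA, Function.update_of_ne (hne _ hA), hb]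
    · obtain ⟨h2, h3⟩ := h.closed x hx hN ho w hw e
      simp [Function.update_of_ne (hne _ hx), Function.update_of_ne (hne _ h2), h2, h3]

theorem exists_attractor [Finite V] (E : V → V → Prop) (own : V → Bool) (p : Bool) (hN : N ⊆ U) :
    ∃ A s r, Attracts E own U p N A s r ∧ ∀ v ∈ U, Forces E own U p A v → v ∈ A := by
  obtain ⟨A, hA⟩ := (Set.toFinite {A : Set V | ∃ s r, Attracts E own U p N A s r}).exists_maximal
    ⟨N, id, fun _ => 0, hN, subset_rfl, fun v h h' => (h' h).elim, fun v h h' => (h' h).elim⟩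
  obtain ⟨s, r, hs⟩ := hA.prop
  refine ⟨A, s, r, hs, fun v hv hf => ?_⟩
  by_contra hvA
  exact hvA (hA.le_of_ge (hs.insert hv hvA hf) (Set.subset_insert v A) (Set.mem_insert v A))

theorem Attracts.exists_visit {r : V → ℕ} (h : Attracts E own U p N A s r) {ρ : ℕ → V}
    (hU : ∀ n, ρ n ∈ U) (hE : ∀ n, E (ρ n) (ρ (n + 1)))
    (hs : ∀ n, ρ n ∈ A → ρ n ∉ N → own (ρ n) = p → ρ (n + 1) = s (ρ n)) (n : ℕ) (hn : ρ n ∈ A) :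
    ∃ m ≥ n, ρ m ∈ N := by
  induction hk : r (ρ n) using Nat.strong_induction_on generalizing n with
  | _ k ih =>
    subst hk
    by_cases hN : ρ n ∈ N
    · exact ⟨n, le_rfl, hN⟩
    have key : ρ (n + 1) ∈ A ∧ r (ρ (n + 1)) < r (ρ n) := by
      by_cases ho : own (ρ n) = p
      · rw [hs n hn hN ho]
        exact (h.move _ hn hN ho).2
      · exact h.closed _ hn hN ho _ (hU _) (hE n)
    obtain ⟨m, hm, hmN⟩ := ih _ key.2 (n + 1) key.1 rfl
    exact ⟨m, by omega, hmN⟩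

/-- If player `p` wins everywhere outside her attractor of the states of the least colour, then she
wins everywhere. -/
theorem Attracts.region [Finite V] {r : V → ℕ} {d : ℕ} (hU : ∀ v ∈ U, ∃ w ∈ U, E v w)
    (hd : ∀ v ∈ U, d ≤ κ v)
    (h : Attracts E own U (decide (Even d)) {v ∈ U | κ v = d} A s r)
    (ht : Region E own κ (U \ A) (decide (Even d)) (U \ A) t) :
    ∃ s', Region E own κ U (decide (Even d)) U s' := by
  classical
  choose! f hfU hfE using hU
  refine ⟨fun v => if v ∈ A then (if κ v = d then f v else s v) else t v,
    subset_rfl, ?_, fun _ _ _ w hw _ => hw, ?_⟩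
  · intro v hv ho
    by_cases hA : v ∈ A
    · by_cases hc : κ v = d
      · simpa [hA, hc] using ⟨hfE v hv, hfU v hv⟩
      · have := h.move v hA (fun hx => hc hx.2) ho
        simpa [hA, hc] using ⟨this.1, h.subset this.2.1⟩
    · have := ht.move v ⟨hv, hA⟩ ho
      simpa [hA] using ⟨this.1, this.2.1⟩
  · intro ρ hρ hE hs
    -- Either the play finally stays outside `A`, where `t` wins, or it returns to `A` forever and
    -- each return forces a visit to colour `d`.
    by_cases hex : ∃ k, ∀ n, ρ (n + k) ∉ A
    · obtain ⟨k, hk⟩ := hex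
      refine ParityWin.of_shift k (ht.wins _ (fun n => ⟨hρ _, hk n⟩) (fun n => ?_) (fun n ho => ?_))
      · simpa only [show n + 1 + k = n + k + 1 by omega] using hE (n + k)
      · simpa only [show n + 1 + k = n + k + 1 by omega, if_neg (hk n)] using hs (n + k) ho
    · push Not at hex
      refine ParityWin.of_frequently_min (fun n => hd _ (hρ n)) (fun n => ?_)
      obtain ⟨k, hk⟩ := hex n
      obtain ⟨m, hm, hmN⟩ := h.exists_visit hρ hE (fun n hA hN ho => by
        rw [hs n ho, if_pos hA, if_neg (fun hc => hN ⟨hρ n, hc⟩)]) _ hk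
      exact ⟨m, by omega, hmN.2⟩

/-- Positional determinacy of parity games on finite graphs. -/
theorem exists_regions [Finite V] (E : V → V → Prop) (own : V → Bool) (κ : V → ℕ) (U : Set V)
    (hU : ∀ v ∈ U, ∃ w ∈ U, E v w) :
    ∃ (R : Bool → Set V) (s : Bool → V → V),
      (∀ p, Region E own κ U p (R p) (s p)) ∧ ∀ p, R (!p) = U \ R p := by
  induction hn : U.ncard using Nat.strong_induction_on generalizing U with
  | _ n ih =>
  subst hn
  rcases U.eq_empty_or_nonempty with rfl | hne
  · exact ⟨fun _ => ∅, fun _ => id, fun _ => Region.empty, by simp⟩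
  have hlt : ∀ X : Set V, (X ∩ U).Nonempty → (U \ X).ncard < U.ncard := by
    rintro X ⟨x, hx, hxU⟩
    exact Set.ncard_lt_ncard ⟨Set.sdiff_subset, fun h => (h hxU).2 hx⟩ (Set.toFinite U)
  obtain ⟨v₀, hv₀, hmin⟩ := Set.exists_min_image U κ (Set.toFinite U) hne
  obtain ⟨d, rfl⟩ : ∃ d, d = κ v₀ := ⟨_, rfl⟩
  set p := decide (Even (κ v₀)) with hp
  have hnot : ∀ b, b ≠ p ↔ b = !p := by intro b; cases b <;> cases p <;> simp
  -- Take a maximal winning region of the opponent of `p`, the player favoured by the least colour.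
  -- Its maximality leaves the opponent nothing to win in the smaller games below.
  obtain ⟨W, hW⟩ := (Set.toFinite {W : Set V | ∃ s, Region E own κ U (!p) W s}).exists_maximal
    ⟨∅, id, Region.empty⟩
  obtain ⟨s, hs⟩ := hW.prop
  have hWf : ∀ v ∈ U, Forces E own U (!p) W v → v ∈ W := by
    intro v hv hf
    by_contra hvW
    exact hvW (hW.le_of_ge (hs.insert hv hvW hf) (Set.subset_insert v W) (Set.mem_insert v W))
  suffices ∃ t, Region E own κ U p (U \ W) t by
    obtain ⟨t, ht⟩ := this
    refine ⟨fun b => if b = p then U \ W else W, fun b => if b = p then t else s, fun b => ?_,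
      fun b => ?_⟩
    · by_cases hb : b = p
      · subst hb
        simpa using ht
      · obtain rfl := (hnot b).1 hb
        simpa using hs
    · by_cases hb : b = p
      · subst hb
        simp [Set.inter_eq_self_of_subset_right hs.subset]
      · obtain rfl := (hnot b).1 hb
        simp
  rcases W.eq_empty_or_nonempty with rfl | hWne
  · obtain ⟨A, a, r, hA, hAf⟩ := exists_attractor E own (U := U) (N := {v ∈ U | κ v = κ v₀}) p
      (fun v hv => hv.1)
    obtain ⟨R, f, hR, hRc⟩ := ih _ (hlt A ⟨v₀, hA.target ⟨hv₀, rfl⟩, hv₀⟩) _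
      (exists_succ_diff hU hAf) rfl
    have hR0 : R (!p) = ∅ := by
      refine Set.subset_empty_iff.1 (hW.le_of_ge ⟨f (!p), (hR (!p)).of_diff ?_⟩ (Set.empty_subset _))
      intro v hv ho w hw e
      exact hv.2 (hAf v hv.1 (Or.inl ⟨by simpa using ho, w, hw, e⟩))
    have hRp : R p = U \ A := by
      have := hRc (!p)
      rwa [Bool.not_not, hR0, Set.sdiff_empty] at this
    rw [Set.sdiff_empty]
    exact hA.region hU hmin (hRp ▸ hR p)
  · obtain ⟨R, f, hR, hRc⟩ := ih _ (hlt W (by rwa [Set.inter_eq_self_of_subset_left hs.subset])) _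
      (exists_succ_diff hU hWf) rfl
    have hR0 : R (!p) = ∅ := by
      refine Set.eq_empty_of_forall_notMem fun v hv => ((hR _).subset hv).2 ?_
      exact hW.le_of_ge (hs.extend (hR _)) Set.subset_union_left (Or.inr hv)
    have hRp : R p = U \ W := by
      have := hRc (!p)
      rwa [Bool.not_not, hR0, Set.sdiff_empty] at this
    refine ⟨f p, (hRp ▸ hR p).of_diff fun v hv ho w hw e => ?_⟩
    exact hv.2 (hWf v hv.1 (Or.inl ⟨(hnot _).1 ho, w, hw, e⟩))

end Determinacy

/-! ### Pruning the game graph -/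

section SubgamePerfect

variable {P V : Type*}

/-- `W` is closed under the transitions `E`, and all plays with transitions `E` inside `W` satisfy
the parity condition for `κ`. -/
def AllWin (E : V → V → Prop) (κ : V → ℕ) (W : Set V) : Prop :=
  (∀ v ∈ W, ∀ w, E v w → w ∈ W) ∧
    ∀ ρ : ℕ → V, (∀ n, ρ n ∈ W) → (∀ n, E (ρ n) (ρ (n + 1))) → ParityWin κ true ρ

theorem AllWin.mono {E E' : V → V → Prop} {κ : V → ℕ} {W : Set V} (h : AllWin E κ W)
    (hE : ∀ v w, E' v w → E v w) : AllWin E' κ W :=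
  ⟨fun v hv w e => h.1 v hv w (hE v w e), fun ρ h1 h2 => h.2 ρ h1 fun n => hE _ _ (h2 n)⟩

/-- A subgraph in which every player `i` wins all plays from `W i`, the other players can make
player `i` lose from outside `W i`, and no transition of player `i` outside `W i` is missing. -/
theorem exists_pruned [Finite V] (adj : V → V → Prop) (hadj : ∀ v, ∃ w, adj v w) (owner : V → P)
    (κ : P → V → ℕ) :
    ∃ (E : V → V → Prop) (W : P → Set V) (t : P → V → V),
      (∀ v w, E v w → adj v w) ∧ (∀ v, ∃ w, E v w) ∧ (∀ i, AllWin E (κ i) (W i)) ∧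
      (∀ i v, v ∉ W i → owner v = i → ∀ w, adj v w → E v w ∧ w ∉ W i) ∧
      (∀ i v, v ∉ W i → owner v ≠ i → E v (t i v) ∧ t i v ∉ W i) ∧
      ∀ i (ρ : ℕ → V), (∀ n, ρ n ∉ W i) → (∀ n, E (ρ n) (ρ (n + 1))) →
        (∀ n, owner (ρ n) ≠ i → ρ (n + 1) = t i (ρ n)) → ParityWin (κ i) false ρ := by
  classical
  -- A transition may be missing only where its owner wins all plays in `E`; this condition survives
  -- further pruning by `AllWin.mono`.
  obtain ⟨E, hE⟩ := (Set.toFinite {E : V → V → Prop | (∀ v w, E v w → adj v w) ∧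
    (∀ v, ∃ w, E v w) ∧ ∀ v w, adj v w → ¬ E v w → ∃ W, v ∈ W ∧ AllWin E (κ (owner v)) W})
    |>.exists_minimal ⟨adj, fun _ _ => id, hadj, fun v w h h' => (h' h).elim⟩
  obtain ⟨hsub, htot, hmiss⟩ := hE.prop
  have hdet := fun i => exists_regions E (fun v => decide (owner v = i)) (κ i) Set.univ
    (fun v _ => by simpa using htot v)
  choose R s hR hRc using hdet
  have hRf : ∀ i v, v ∈ R i false ↔ v ∉ R i true := fun i v => by
    rw [← Bool.not_true, hRc i true]; simp
  have hall : ∀ i, AllWin E (κ i) (R i true) := by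
    intro i
    let E' : V → V → Prop := fun v w => E v w ∧ (owner v = i → v ∈ R i true → w = s i true v)
    have hwin : AllWin E' (κ i) (R i true) := by
      constructor
      · intro v hv w e
        by_cases ho : owner v = i
        · rw [e.2 ho hv]
          exact ((hR i true).move v hv (by simpa using ho)).2
        · exact (hR i true).closed v hv (by simpa using ho) w trivial e.1
      · intro ρ hρ he
        exact (hR i true).wins ρ hρ (fun n => (he n).1)
          (fun n ho => (he n).2 (by simpa using ho) (hρ n))
    -- Fixing the winning moves of `i` gives an admissible subgraph `E'`; by minimality `E` already
    -- obeys them.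
    refine hwin.mono (hE.le_of_le ⟨fun v w e => hsub v w e.1, fun v => ?_, fun v w ha hn => ?_⟩
      (fun v w e => e.1))
    · by_cases hv : owner v = i ∧ v ∈ R i true
      · exact ⟨s i true v, ((hR i true).move v hv.2 (by simpa using hv.1)).1, fun _ _ => rfl⟩
      · obtain ⟨w, hw⟩ := htot v
        exact ⟨w, hw, fun h1 h2 => (hv ⟨h1, h2⟩).elim⟩
    · by_cases he : E v w
      · have : owner v = i ∧ v ∈ R i true := by
          by_contra hc
          exact hn ⟨he, fun h1 h2 => (hc ⟨h1, h2⟩).elim⟩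
        exact ⟨R i true, this.2, this.1.symm ▸ hwin⟩
      · obtain ⟨X, hX, hXw⟩ := hmiss v w ha he
        exact ⟨X, hX, hXw.mono fun v w e => e.1⟩
  have hcoal : ∀ i v, v ∉ R i true → owner v ≠ i → E v (s i false v) ∧ s i false v ∉ R i true := by
    intro i v hv ho
    have := (hR i false).move v ((hRf i v).2 hv) (by simpa using ho)
    exact ⟨this.1, (hRf i _).1 this.2⟩
  have hlose : ∀ i (ρ : ℕ → V), (∀ n, ρ n ∉ R i true) → (∀ n, E (ρ n) (ρ (n + 1))) →
      (∀ n, owner (ρ n) ≠ i → ρ (n + 1) = s i false (ρ n)) → ParityWin (κ i) false ρ :=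
    fun i ρ hρ he ht => (hR i false).wins ρ (fun n => (hRf i _).2 (hρ n)) he
      (fun n ho => ht n (by simpa using ho))
  have hown : ∀ i v, v ∉ R i true → owner v = i → ∀ w, E v w → w ∉ R i true :=
    fun i v hv ho w e =>
      (hRf i w).1 ((hR i false).closed v ((hRf i v).2 hv) (by simpa using ho) w trivial e)
  refine ⟨E, fun i => R i true, fun i => s i false, hsub, htot, hall, ?_, hcoal, hlose⟩
  intro i v hv ho w ha
  suffices he : E v w from ⟨he, hown i v hv ho w he⟩
  by_contra he
  obtain ⟨X, hX, hXw⟩ := hmiss v w ha he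
  choose f hf using htot
  -- If a transition of `i` were missing at `v` outside her region, the play generated by `g` would
  -- stay in `X`, hence be won by `i`, yet follow the coalition strategy, hence be lost.
  let g : V → V := fun x => if owner x = i then f x else s i false x
  have hg : ∀ x, x ∉ R i true → E x (g x) ∧ g x ∉ R i true := by
    intro x hx
    by_cases hxo : owner x = i
    · simpa [g, hxo] using ⟨hf x, hown i x hx hxo _ (hf x)⟩
    · simpa [g, hxo] using hcoal i x hx hxo
  have hρ : ∀ n, g^[n] v ∉ R i true := by
    intro n
    induction n with
    | zero => exact hv
    | succ n ih =>
      rw [Function.iterate_succ_apply']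
      exact (hg _ ih).2
  have hρE : ∀ n, E (g^[n] v) (g^[n + 1] v) := fun n => by
    rw [Function.iterate_succ_apply']
    exact (hg _ (hρ n)).1
  have hρX : ∀ n, g^[n] v ∈ X := by
    intro n
    induction n with
    | zero => exact hX
    | succ n ih => exact hXw.1 _ ih _ (hρE n)
  have h1 := hXw.2 _ hρX hρE
  have h2 := hlose i _ hρ hρE (fun n hn => by
    rw [Function.iterate_succ_apply']
    simp [g, hn])
  rw [ho] at h1
  simp only [ParityWin] at h1 h2
  simp [h1] at h2

/-! ### Memory of deviations, and plays after a history -/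

open Classical in
/-- The player to be punished and the last state after the states `h`: after a transition different
from the one prescribed by `c`, the player who took it is punished. -/
noncomputable def memory (owner : V → P) (c : P → V → V) (x : P × V) (h : List V) : P × V :=
  h.foldl (fun x w => (if w = c x.1 x.2 then x.1 else owner x.2, w)) x

open Classical in
theorem memory_concat (owner : V → P) (c : P → V → V) (x : P × V) (h : List V) (v w : V) :
    (memory owner c x (h ++ [v] ++ [w])).1 =
      if w = c (memory owner c x (h ++ [v])).1 v then (memory owner c x (h ++ [v])).1
      else owner v := by
  simp [memory, List.foldl_append]

theorem infOcc_prepend (h : List V) (ρ : ℕ → V) : infOcc (prepend h ρ) = infOcc ρ := by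
  rw [← infOcc_shift (prepend h ρ) h.length]
  simp [prepend]

theorem isPlay_prepend {G : BoolGame P V} {v₀ : V} {h : List V} {ρ : ℕ → V}
    (hh : G.IsHistory v₀ (h ++ [ρ 0])) (hρ : G.IsPlay ρ) : G.IsPlay (prepend h ρ) := by
  intro n
  rcases lt_or_ge n h.length with hn | hn
  · have e : ∀ m ≤ h.length, prepend h ρ m = (h ++ [ρ 0])[m]?.getD (ρ 0) := by
      intro m hm
      rcases hm.lt_or_eq with hm | rfl
      · simp [prepend, List.getElem?_append_left hm, List.getElem?_eq_getElem hm]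
      · simp [prepend]
    rw [e n hn.le, e (n + 1) hn]
    have := List.isChain_iff_getElem.1 hh.2 n (by simpa using hn)
    rwa [List.getElem?_eq_getElem (by simp; omega), List.getElem?_eq_getElem (by simp; omega)]
  · have := hρ (n - h.length)
    simp only [prepend, List.getElem?_eq_none hn,
      List.getElem?_eq_none (show h.length ≤ n + 1 by omega), Option.getD_none]
    rwa [show n + 1 - h.length = n - h.length + 1 by omega]

theorem run_isHistory (G : BoolGame P V) {v₀ : V} (σ : G.Profile v₀) (n : ℕ) :
    G.IsHistory v₀ ((G.run σ n).1 ++ [(G.run σ n).2]) := by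
  induction n with
  | zero => simp [run, IsHistory]
  | succ n ih =>
    have e := (σ (G.owner (G.run σ n).2)).adj_next _ _ ih rfl
    have := IsHistory.append (g := [(G.run σ n).2, (G.run σ (n + 1)).2]) ih
      ⟨rfl, by simpa [run] using e⟩
    simpa [run] using this

theorem outcome_isPlay (G : BoolGame P V) {v₀ : V} (σ : G.Profile v₀) : G.IsPlay (G.outcome σ) :=
  fun n => (σ (G.owner (G.run σ n).2)).adj_next _ _ (run_isHistory G σ n) rfl

end SubgamePerfect

end BoolGame

theorem mainTheorem8 {P V : Type*} [Finite P] [Finite V] (G : BoolGame P V) (hG : G.IsParity)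
    (v₀ : V) : ∃ σ : G.Profile v₀, G.IsSPE σ := by
  classical
  obtain ⟨κ, hκ⟩ := hG
  obtain ⟨E, W, t, hsub, htot, hall, hown, hcoal, hlose⟩ :=
    BoolGame.exists_pruned G.graph.Adj G.exists_succ G.owner κ
  choose f hf using htot
  let c : P → V → V := fun j v => if G.owner v ≠ j ∧ v ∉ W j then t j v else f v
  have hcE : ∀ j v, E v (c j v) := by
    intro j v
    by_cases h : G.owner v ≠ j ∧ v ∉ W j
    · simpa only [c, if_pos h] using (hcoal j v h.2 h.1).1
    · simpa only [c, if_neg h] using hf v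
  -- The fold also reads the initial `v₀` as a move from `v₀`; whether or not it matches `c`, the
  -- memory remains `G.owner v₀`, a harmless default.
  let M : List V → P := fun h => (BoolGame.memory G.owner c (G.owner v₀, v₀) h).1
  have hM : ∀ h v w, M (h ++ [v] ++ [w]) = if w = c (M (h ++ [v])) v then M (h ++ [v])
      else G.owner v := fun h v w => BoolGame.memory_concat _ _ _ _ _ _
  let σ : G.Profile v₀ := fun i => ⟨fun h v => c (M (h ++ [v])) v, fun h v _ _ => hsub _ _ (hcE _ _)⟩
  refine ⟨σ, fun h v hv i τ => ?_⟩
  let σh : (G.after h).Profile v := fun i => (σ i).sub h v hv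
  have hval : ∀ (θ : (G.after h).Profile v),
      G.payoff (BoolGame.prepend h ((G.after h).outcome θ)) i = 1 ↔
        BoolGame.ParityWin (κ i) true ((G.after h).outcome θ) := by
    intro θ
    have hp : G.IsPlay ((G.after h).outcome θ) := (G.after h).outcome_isPlay θ
    rw [hκ _ (BoolGame.isPlay_prepend hv hp) i, BoolGame.infOcc_prepend]
    simp [BoolGame.ParityWin]
  suffices key : G.payoff (BoolGame.prepend h ((G.after h).outcome (Function.update σh i τ))) i = 1 →
      G.payoff (BoolGame.prepend h ((G.after h).outcome σh)) i = 1 by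
    change G.payoff (BoolGame.prepend h ((G.after h).outcome (Function.update σh i τ))) i ≤
      G.payoff (BoolGame.prepend h ((G.after h).outcome σh)) i
    revert key
    generalize G.payoff (BoolGame.prepend h ((G.after h).outcome (Function.update σh i τ))) i = a
    generalize G.payoff (BoolGame.prepend h ((G.after h).outcome σh)) i = b
    revert a b
    decide
  rw [hval, hval]
  intro hdev
  by_contra hlost
  let m : (G.after h).Profile v → ℕ → P := fun θ n =>
    M (h ++ ((G.after h).run θ n).1 ++ [((G.after h).run θ n).2])
  have hm : ∀ θ n, m θ (n + 1) =
      if (G.after h).outcome θ (n + 1) = c (m θ n) ((G.after h).outcome θ n) then m θ n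
      else G.owner ((G.after h).outcome θ n) := by
    intro θ n
    have := hM (h ++ ((G.after h).run θ n).1) ((G.after h).run θ n).2
      ((G.after h).run θ (n + 1)).2
    simpa [m, BoolGame.outcome, BoolGame.run] using this
  set ρ := (G.after h).outcome σh with hρ
  set ρ' := (G.after h).outcome (Function.update σh i τ) with hρ'
  have hnext : ∀ n, ρ (n + 1) = c (m σh n) (ρ n) := by
    intro n
    simp [ρ, BoolGame.outcome, BoolGame.run, σh, σ, BoolGame.Strategy.sub, m]
  have hnext' : ∀ n, G.owner (ρ' n) ≠ i → ρ' (n + 1) = c (m (Function.update σh i τ) n) (ρ' n) := by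
    intro n ho
    have : (G.after h).owner ((G.after h).run (Function.update σh i τ) n).2 ≠ i := ho
    change ((Function.update σh i τ) ((G.after h).owner
      ((G.after h).run (Function.update σh i τ) n).2)).next _ _ = _
    rw [Function.update_of_ne this]
    simp [BoolGame.outcome, σh, σ, BoolGame.Strategy.sub, m, ρ']
  have hplay' : ∀ n, G.graph.Adj (ρ' n) (ρ' (n + 1)) := (G.after h).outcome_isPlay _
  -- Prescribed moves all lie in `E`, so a visit to `W i` would make `i` win `ρ`.
  have hρW : ∀ n, ρ n ∉ W i := by
    intro k hk
    have hstep : ∀ n, E (ρ n) (ρ (n + 1)) := fun n => hnext n ▸ hcE _ _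
    have hstay : ∀ n, ρ (n + k) ∈ W i := by
      intro n
      induction n with
      | zero => simpa using hk
      | succ n ih => exact (hall i).1 _ ih _ (by
          simpa only [show n + 1 + k = n + k + 1 by omega] using hstep (n + k))
    refine hlost (BoolGame.ParityWin.of_shift k ((hall i).2 _ hstay fun n => ?_))
    simpa only [show n + 1 + k = n + k + 1 by omega] using hstep (n + k)
  have hmconst : ∀ n, m σh (n + 1) = m σh n := fun n => by
    rw [hm, ← hρ, if_pos (hnext n)]
  -- Only `i` can depart from `c`, and doing so again just names `i` again.
  have hm' : ∀ n, m (Function.update σh i τ) n = i → m (Function.update σh i τ) (n + 1) = i := by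
    intro n hn
    rw [hm, ← hρ']
    split_ifs with hc
    · exact hn
    · by_contra ho
      exact hc (hnext' n ho)
  -- While the memory does not name `i`, the play still agrees with `ρ`; afterwards `hown` and
  -- `hcoal` keep it outside `W i`.
  have hinv : ∀ n, ρ' n ∉ W i ∧ (m (Function.update σh i τ) n = i ∨
      (ρ' n = ρ n ∧ m (Function.update σh i τ) n = m σh n)) := by
    intro n
    induction n with
    | zero => exact ⟨hρW 0, Or.inr ⟨rfl, rfl⟩⟩
    | succ n ih =>
      obtain ⟨hW, hor⟩ := ih
      by_cases ho : G.owner (ρ' n) = i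
      · refine ⟨(hown i _ hW ho _ (hplay' n)).2, ?_⟩
        rcases hor with hi | ⟨h1, h2⟩
        · exact Or.inl (hm' n hi)
        · rw [hm, ← hρ']
          split_ifs with hc
          · exact Or.inr ⟨by rw [hc, h1, h2, hnext], by rw [hmconst, h2]⟩
          · exact Or.inl ho
      · rcases hor with hi | ⟨h1, h2⟩
        · refine ⟨?_, Or.inl (hm' n hi)⟩
          rw [hnext' n ho, hi]
          simp only [c, if_pos (And.intro ho hW)]
          exact (hcoal i _ hW ho).2
        · have e : ρ' (n + 1) = ρ (n + 1) := by rw [hnext' n ho, h1, h2, hnext]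
          refine ⟨e ▸ hρW _, Or.inr ⟨e, ?_⟩⟩
          rw [hm, ← hρ', if_pos (hnext' n ho), hmconst, h2]
  by_cases hex : ∃ k, m (Function.update σh i τ) k = i
  · obtain ⟨k, hk⟩ := hex
    have hmi : ∀ n, m (Function.update σh i τ) (n + k) = i := by
      intro n
      induction n with
      | zero => simpa using hk
      | succ n ih =>
        rw [show n + 1 + k = n + k + 1 by omega]
        exact hm' _ ih
    have ht : ∀ n, G.owner (ρ' (n + k)) ≠ i → ρ' (n + k + 1) = t i (ρ' (n + k)) := by
      intro n ho
      rw [hnext' _ ho, hmi]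
      simp only [c, if_pos (And.intro ho (hinv (n + k)).1)]
    have hfalse : BoolGame.ParityWin (κ i) false ρ' := by
      refine BoolGame.ParityWin.of_shift k (hlose i _ (fun n => (hinv (n + k)).1) ?_ ?_)
      · intro n
        simp only [show n + 1 + k = n + k + 1 by omega]
        by_cases ho : G.owner (ρ' (n + k)) = i
        · exact (hown i _ (hinv (n + k)).1 ho _ (hplay' _)).1
        · rw [ht n ho]
          exact (hcoal i _ (hinv (n + k)).1 ho).1
      · intro n ho
        simpa only [show n + 1 + k = n + k + 1 by omega] using ht n ho
    simp only [BoolGame.ParityWin] at hdev hfalse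
    simp [hdev] at hfalse
  · push Not at hex
    have : ρ' = ρ := funext fun n => ((hinv n).2.resolve_left (hex n)).1
    exact hlost (this ▸ hdev)
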